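/- Let $\alpha\in(1,2)$ and $u>0$. The ellipses model with parameters $(u,\alpha)$ is the Poisson point process on $\mathbb{R}^2\times[1,\infty)\times(-\pi/2,\pi/2]$ with intensity measure $u\,\mathrm{d}z\otimes\alpha R^{-(1+\alpha)}\,\mathrm{d}R\otimes\pi^{-1}\,\mathrm{d}V$; each point $(z,R,V)$ of it stands for the closed filled ellipse centred at $z$ with semi-minor axis $1$ and semi-major axis $R$, the latter making an angle $V$ with the horizontal axis. Let $B(l)$ be the closed Euclidean ball of radius $l$ about the origin. Write $A_1\leftrightarrow_1A_2$ if a single ellipse of the model meets both $A_1$ and $A_2$. For $0<l_1<l_2$ let $D(l_1,l_2)$, the chemical distance between $B(l_1)$ and $\partial B(l_2)$, be the least number of ellipses of the model whose union contains a continuous path from a point of $B(l_1)$ to a point of $\partial B(l_2)$ (and $\infty$ if there is no such path). There is a constant $c_2=c_2(\alpha)>0$ such that for every $u>0$ and all $l_1\ge 1$, $l_2\ge l_1+2$, $$\mathbb{P}\bigl(B(l_1)\leftrightarrow_1\partial B(l_2)\bigr)\le 1-\exp\bigl[-u\,c_2\,l_1\,(l_2-l_1)^{1-\alpha}\bigr].\qquad(*)$$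 Moreover, let $c_2>0$ be any constant such that $(*)$ holds for every $u>0$ and all such $l_1,l_2$. For $u>0$ put $\gamma=\frac{\alpha-1}{2}$ and $C=\max\{15,\;u\,2^{\alpha-1}c_2\}$. Then for every integer $n\ge0$ and every $x\in\mathbb{R}^2$ with $|x|>2^{\gamma^{1-n-2^n}}$, $$\mathbb{P}\bigl(D(1,|x|)\le 2^n\bigr)\le C^{\,n+1}\,|x|^{-2\gamma^{2^n}}.$$ -/

import Mathlib

open MeasureTheory ProbabilityTheory
open scoped ENNReal

universe v

namespace EllipsesModel

/-- The Euclidean plane. -/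
abbrev Plane : Type := EuclideanSpace ℝ (Fin 2)

/-- Parameters `(z, R, V)` of an ellipse: centre, semi-major axis, angle. -/
abbrev Param : Type := Plane × ℝ × ℝ

/-- The closed filled ellipse with parameters `(z, R, V)`: it is centred at `z`, its semi-minor axis
is `1`, its semi-major axis is `R`, and the latter makes an angle `V` with the horizontal axis. -/
def ellipse (p : Param) : Set Plane :=
  {y | (((y 0 - p.1 0) * Real.cos p.2.2 + (y 1 - p.1 1) * Real.sin p.2.2) / p.2.1) ^ 2
      + (-(y 0 - p.1 0) * Real.sin p.2.2 + (y 1 - p.1 1) * Real.cos p.2.2) ^ 2 ≤ 1}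

/-- The law `α R^{-(1+α)} dR` on `[1, ∞)` of the semi-major axes. -/
noncomputable def axisLaw (α : ℝ) : Measure ℝ :=
  (volume.restrict (Set.Ici 1)).withDensity (fun R => ENNReal.ofReal (α * R ^ (-(1 + α))))

/-- The uniform law on `(-π/2, π/2]` of the angles. -/
noncomputable def angleLaw : Measure ℝ :=
  ENNReal.ofReal (1 / Real.pi) • volume.restrict (Set.Ioc (-(Real.pi / 2)) (Real.pi / 2))

/-- The intensity measure `u dz ⊗ α R^{-(1+α)} dR ⊗ π⁻¹ dV` of the ellipses model. -/
noncomputable def intensity (u α : ℝ) : Measure Param :=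
  ENNReal.ofReal u • (volume : Measure Plane).prod ((axisLaw α).prod angleLaw)

/-- `ξ` is a (simple) Poisson point process with intensity measure `Λ`, regarded as a random set of
points: the number of points in a measurable set `B` is a random variable, which is Poisson with
mean `Λ B` when `Λ B` is finite, and the numbers of points in disjoint sets are independent. -/
structure IsPoissonPointProcess {E : Type*} [MeasurableSpace E] {Ω : Type*} [MeasurableSpace Ω]
    (P : Measure Ω) (ξ : Ω → Set E) (Λ : Measure E) : Prop where
  measurable_count : ∀ B : Set E, MeasurableSet B → Measurable fun ω => (ξ ω ∩ B).encard
  hasLaw_count : ∀ B : Set E, MeasurableSet B → Λ B ≠ ∞ →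
    HasLaw (fun ω => (ξ ω ∩ B).encard)
      ((poissonMeasure (Λ B).toNNReal).map (Nat.cast : ℕ → ℕ∞)) P
  iIndepFun_count : ∀ (m : ℕ) (B : Fin m → Set E), (∀ i, MeasurableSet (B i)) →
    Pairwise (fun i j => Disjoint (B i) (B j)) →
    iIndepFun (fun i ω => (ξ ω ∩ B i).encard) P

/-- `ξ` is (the point process of) the ellipses model with parameters `u` and `α`. -/
def IsEllipsesModel {Ω : Type*} [MeasurableSpace Ω] (P : Measure Ω) (ξ : Ω → Set Param)
    (u α : ℝ) : Prop :=
  IsPoissonPointProcess P ξ (intensity u α)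

/-- `A₁ ↔₁ A₂` in the configuration `η`: a single ellipse of `η` meets both `A₁` and `A₂`. -/
def OneConnected (η : Set Param) (A₁ A₂ : Set Plane) : Prop :=
  ∃ p ∈ η, (ellipse p ∩ A₁).Nonempty ∧ (ellipse p ∩ A₂).Nonempty

/-- The chemical distance between two points in the configuration `η`: the least number of ellipses
of `η` whose union contains a continuous path from `x` to `y`, and `⊤` if there is no such path. -/
noncomputable def chemDist (η : Set Param) (x y : Plane) : ℕ∞ :=
  ⨅ (F : Finset Param) (_ : (F : Set Param) ⊆ η) (_ : JoinedIn (⋃ p ∈ F, ellipse p) x y),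
    (F.card : ℕ∞)

/-- The chemical distance between two sets. -/
noncomputable def chemDistSets (η : Set Param) (A₁ A₂ : Set Plane) : ℕ∞ :=
  ⨅ (x ∈ A₁) (y ∈ A₂), chemDist η x y

/-- `B(l)`: the Euclidean ball of radius `l` centred at the origin. -/
def ball (l : ℝ) : Set Plane := Metric.closedBall 0 l

/-- `D(l₁, l₂)`: the chemical distance between `B(l₁)` and `∂B(l₂)`. -/
noncomputable def annulusChemDist (η : Set Param) (l₁ l₂ : ℝ) : ℕ∞ :=
  chemDistSets η (ball l₁) (frontier (ball l₂))

/-- `c` is an admissible constant in the one-ellipse annulus-crossing bound for the exponent `α`;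
it may not depend on `u`, `l₁`, `l₂`. -/
def IsAnnulusConstant (α c : ℝ) : Prop :=
  0 < c ∧ ∀ (u : ℝ), 0 < u → ∀ (Ω : Type v) [MeasurableSpace Ω] (P : Measure Ω)
    [IsProbabilityMeasure P] (ξ : Ω → Set Param), IsEllipsesModel P ξ u α →
    ∀ l₁ l₂ : ℝ, 1 ≤ l₁ → 2 ≤ l₂ - l₁ →
      P {ω | OneConnected (ξ ω) (ball l₁) (frontier (ball l₂))} ≤
        ENNReal.ofReal (1 - Real.exp (-(u * c * l₁ * (l₂ - l₁) ^ (1 - α))))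

end EllipsesModel

/-!
The constant. An ellipse with semi-major axis `R ≥ 1` that meets both `B(l₁)` and `∂B(l₂)` satisfies
`2 R ≥ l₂ - l₁`, and for given `R` and `V` its centre lies in a set of area `O(l₁ R)`: a rotated box
when `R ≥ l₁`, an annulus around the origin when `R < l₁`. Integrating `l₁ R · R^{-(1+α)}` over
`R ≥ (l₂ - l₁) / 2` gives an expected number `O(u l₁ (l₂ - l₁)^{1-α})` of such ellipses
(`intensity_crossingParams_le`), and the void probability of a Poisson point process turns this into
the one-ellipse bound (`exists_isAnnulusConstant`).

The chemical distance. A path in a union of `k` ellipses yields a chain of `k` steps, each inside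
one ellipse (`Chain.of_continuousOn`). If at most `2 ^ (n + 1)` ellipses link
the unit ball about `c` to the circle of radius `r` about `c`, let `l = r ^ g` with
`g = γ ^ (2 ^ n)`. Either the first half of the chain reaches distance `l` from `c`, or the second
half links a point at distance `l` to the outer circle, hence crosses an annulus with radii `1` and
`r - l` about one of the `O(l)` centres of unit balls covering the circle of radius `l`
(`Crosses.split`). By translation invariance, induction on `n` and the union bound, the probability
is at most `C ^ (n + 1)` times `l ^ (-2 g) + O(l) (r - l) ^ (-2 g)`. As `g ≤ 1 / 2`, both terms are
`O(r ^ (-2 g ^ 2))`, where `g ^ 2 = γ ^ (2 ^ (n + 1))`, and the constants fit into one more factor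
`C ≥ 15` (`recursion_bound`). For `n = 0` the one-ellipse bound applies. Only outer measures of
events are estimated, so no measurability of the crossing events is needed.
-/

namespace EllipsesModel

/-! ### Geometry of a single ellipse -/

/-- The coordinate of `z` along the direction of angle `V`. -/
noncomputable def along (V : ℝ) (z : Plane) : ℝ := z 0 * Real.cos V + z 1 * Real.sin V

/-- The coordinate of `z` along the direction perpendicular to that of angle `V`. -/
noncomputable def across (V : ℝ) (z : Plane) : ℝ := -z 0 * Real.sin V + z 1 * Real.cos V

lemma along_sq_add_across_sq (V : ℝ) (z : Plane) : along V z ^ 2 + across V z ^ 2 = ‖z‖ ^ 2 := by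
  rw [EuclideanSpace.norm_sq_eq, Fin.sum_univ_two, along, across, Real.norm_eq_abs,
    Real.norm_eq_abs, sq_abs, sq_abs]
  linear_combination (z 0 ^ 2 + z 1 ^ 2) * Real.sin_sq_add_cos_sq V

lemma abs_along_le (V : ℝ) (z : Plane) : |along V z| ≤ ‖z‖ :=
  abs_le_of_sq_le_sq (by nlinarith [along_sq_add_across_sq V z, sq_nonneg (across V z)])
    (norm_nonneg z)

lemma abs_across_le (V : ℝ) (z : Plane) : |across V z| ≤ ‖z‖ :=
  abs_le_of_sq_le_sq (by nlinarith [along_sq_add_across_sq V z, sq_nonneg (along V z)])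
    (norm_nonneg z)

lemma across_sub (V : ℝ) (y z : Plane) : across V (y - z) = across V y - across V z := by
  simp only [across, PiLp.sub_apply]; ring

@[fun_prop]
lemma continuous_along : Continuous fun q : ℝ × Plane => along q.1 q.2 := by
  unfold along; fun_prop

@[fun_prop]
lemma continuous_across : Continuous fun q : ℝ × Plane => across q.1 q.2 := by
  unfold across; fun_prop

lemma mem_ellipse_iff {p : Param} {y : Plane} :
    y ∈ ellipse p ↔ (along p.2.2 (y - p.1) / p.2.1) ^ 2 + across p.2.2 (y - p.1) ^ 2 ≤ 1 := by
  simp only [ellipse, along, across, Set.mem_ofPred_eq, PiLp.sub_apply]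

lemma isClosed_ellipse (p : Param) : IsClosed (ellipse p) := by
  have h : Continuous fun y : Plane =>
      (along p.2.2 (y - p.1) / p.2.1) ^ 2 + across p.2.2 (y - p.1) ^ 2 := by
    unfold along across; fun_prop
  have : ellipse p = {y | (along p.2.2 (y - p.1) / p.2.1) ^ 2
      + across p.2.2 (y - p.1) ^ 2 ≤ 1} := by ext y; exact mem_ellipse_iff
  rw [this]
  exact isClosed_le h continuous_const

lemma convex_ellipse (p : Param) : Convex ℝ (ellipse p) := by
  intro x hx y hy a b ha hb hab
  rw [mem_ellipse_iff] at *
  have e₁ : along p.2.2 (a • x + b • y - p.1) / p.2.1 =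
      a * (along p.2.2 (x - p.1) / p.2.1) + b * (along p.2.2 (y - p.1) / p.2.1) := by
    obtain rfl : b = 1 - a := by linarith
    simp only [along, PiLp.sub_apply, PiLp.add_apply, PiLp.smul_apply, smul_eq_mul]
    ring
  have e₂ : across p.2.2 (a • x + b • y - p.1) =
      a * across p.2.2 (x - p.1) + b * across p.2.2 (y - p.1) := by
    obtain rfl : b = 1 - a := by linarith
    simp only [across, PiLp.sub_apply, PiLp.add_apply, PiLp.smul_apply, smul_eq_mul]
    ring
  rw [e₁, e₂]
  generalize along p.2.2 (x - p.1) / p.2.1 = s at *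
  generalize along p.2.2 (y - p.1) / p.2.1 = t at *
  generalize across p.2.2 (x - p.1) = s' at *
  generalize across p.2.2 (y - p.1) = t' at *
  obtain rfl : b = 1 - a := by linarith
  -- the square is convex: the defect is `a b` times a square
  nlinarith [mul_nonneg (mul_nonneg ha hb) (sq_nonneg (s - t)),
    mul_nonneg (mul_nonneg ha hb) (sq_nonneg (s' - t')),
    mul_le_mul_of_nonneg_left hx ha, mul_le_mul_of_nonneg_left hy hb]

lemma abs_across_le_one_of_mem_ellipse {p : Param} {y : Plane} (hy : y ∈ ellipse p) :
    |across p.2.2 (y - p.1)| ≤ 1 := by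
  rw [mem_ellipse_iff] at hy
  exact abs_le_of_sq_le_sq (by nlinarith [sq_nonneg (along p.2.2 (y - p.1) / p.2.1)]) zero_le_one

lemma norm_sub_le_of_mem_ellipse {p : Param} (hR : 1 ≤ p.2.1) {y : Plane} (hy : y ∈ ellipse p) :
    ‖y - p.1‖ ≤ p.2.1 := by
  rw [mem_ellipse_iff, div_pow] at hy
  have hR' : 0 < p.2.1 := by linarith
  refine le_of_sq_le_sq ?_ hR'.le
  rw [← along_sq_add_across_sq p.2.2]
  have h1 : along p.2.2 (y - p.1) ^ 2 =
      along p.2.2 (y - p.1) ^ 2 / p.2.1 ^ 2 * p.2.1 ^ 2 := by field_simp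
  have h2 : across p.2.2 (y - p.1) ^ 2 ≤ across p.2.2 (y - p.1) ^ 2 * p.2.1 ^ 2 :=
    le_mul_of_one_le_right (sq_nonneg _) (by nlinarith)
  nlinarith [mul_le_mul_of_nonneg_right hy (sq_nonneg p.2.1)]

/-! ### The measure of the ellipses crossing an annulus -/

lemma volume_rotated_box (V : ℝ) {a b : ℝ} (ha : 0 ≤ a) :
    volume {z : Plane | |along V z| ≤ a ∧ |across V z| ≤ b} = ENNReal.ofReal (4 * (a * b)) := by
  set M : Matrix (Fin 2) (Fin 2) ℝ :=
    !![Real.cos V, Real.sin V; -Real.sin V, Real.cos V] with hM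
  have hdet : LinearMap.det (Matrix.toLin' M) = 1 := by
    rw [LinearMap.det_toLin', hM, Matrix.det_fin_two_of]
    nlinarith [Real.sin_sq_add_cos_sq V]
  have hset : {z : Plane | |along V z| ≤ a ∧ |across V z| ≤ b} =
      WithLp.ofLp ⁻¹' (Matrix.toLin' M ⁻¹' Set.Icc ![-a, -b] ![a, b]) := by
    ext z
    simp only [Set.mem_ofPred_eq, Set.mem_preimage, Set.mem_Icc, Pi.le_def, Fin.forall_fin_two,
      Matrix.toLin'_apply, hM, Matrix.mulVec, dotProduct, Fin.sum_univ_two, along, across, abs_le]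
    simp only [Matrix.of_apply, Matrix.cons_val_zero, Matrix.cons_val_one]
    constructor
    · rintro ⟨⟨h1, h2⟩, h3, h4⟩
      exact ⟨⟨by linarith, by linarith⟩, by linarith, by linarith⟩
    · rintro ⟨⟨h1, h2⟩, h3, h4⟩
      exact ⟨⟨by linarith, by linarith⟩, by linarith, by linarith⟩
  have hmeas : MeasurableSet (Matrix.toLin' M ⁻¹' Set.Icc ![-a, -b] ![a, b]) :=
    (LinearMap.continuous_of_finiteDimensional _).measurable measurableSet_Icc
  rw [hset, (PiLp.volume_preserving_ofLp (Fin 2)).measure_preimage hmeas.nullMeasurableSet,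
    Measure.addHaar_preimage_linearMap _ (by rw [hdet]; exact one_ne_zero), hdet,
    Real.volume_Icc_pi, Fin.prod_univ_two]
  simp only [Matrix.cons_val_zero, Matrix.cons_val_one, inv_one, abs_one, ENNReal.ofReal_one,
    one_mul]
  rw [← ENNReal.ofReal_mul (by linarith)]
  congr 1; ring

lemma volume_annulus_le {r s : ℝ} (hr : 0 ≤ r) (hrs : r ≤ s) :
    volume {z : Plane | r ≤ ‖z‖ ∧ ‖z‖ ≤ s} ≤ ENNReal.ofReal (Real.pi * (s ^ 2 - r ^ 2)) := by
  have : {z : Plane | r ≤ ‖z‖ ∧ ‖z‖ ≤ s} = Metric.closedBall 0 s \ Metric.ball 0 r := by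
    ext z; simp [and_comm]
  rw [this, measure_sdiff ((Metric.ball_subset_ball hrs).trans Metric.ball_subset_closedBall)
    measurableSet_ball.nullMeasurableSet measure_ball_lt_top.ne,
    EuclideanSpace.volume_closedBall_fin_two, EuclideanSpace.volume_ball_fin_two,
    ← ENNReal.ofReal_pow (hr.trans hrs), ← ENNReal.ofReal_pow hr, ← ENNReal.sub_mul (by simp),
    ← ENNReal.ofReal_sub _ (by positivity)]
  rw [mul_comm Real.pi, ENNReal.ofReal_mul (by nlinarith)]

/-- The parameters that satisfy the constraints which crossing the annulus between the circles of
radii `l₁` and `l₂` imposes on a centre and a semi-major axis `R ≥ 1`. Parameters with `R < 1`, a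
null set for the intensity, are all included, so that every crossing ellipse is. -/
def crossingParams (l₁ l₂ : ℝ) : Set Param :=
  {p | 1 ≤ p.2.1 → (l₂ - l₁ ≤ 2 * p.2.1 ∧ |along p.2.2 p.1| ≤ l₁ + p.2.1 ∧
    |across p.2.2 p.1| ≤ l₁ + 1 ∧ l₂ - p.2.1 ≤ ‖p.1‖ ∧ ‖p.1‖ ≤ l₁ + p.2.1)}

lemma measurableSet_crossingParams (l₁ l₂ : ℝ) : MeasurableSet (crossingParams l₁ l₂) := by
  have h1 : Measurable fun p : Param => along p.2.2 p.1 :=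
    (continuous_along.comp (by fun_prop : Continuous fun p : Param => (p.2.2, p.1))).measurable
  have h2 : Measurable fun p : Param => across p.2.2 p.1 :=
    (continuous_across.comp (by fun_prop : Continuous fun p : Param => (p.2.2, p.1))).measurable
  have hR : Measurable fun p : Param => p.2.1 := by fun_prop
  have hz : Measurable fun p : Param => ‖p.1‖ := by fun_prop
  have ha : ∀ {f : Param → ℝ}, Measurable f → Measurable fun p => |f p| := fun hf =>
    continuous_abs.measurable.comp hf
  refine MeasurableSet.imp (measurableSet_le measurable_const hR)
    ((measurableSet_le measurable_const (hR.const_mul 2)).inter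
    ((measurableSet_le (ha h1) (hR.const_add l₁)).inter
    ((measurableSet_le (ha h2) measurable_const).inter
    ((measurableSet_le (hR.const_sub l₂) hz).inter (measurableSet_le hz (hR.const_add l₁))))))

lemma mem_crossingParams {l₁ l₂ : ℝ} {p : Param}
    (h₁ : (ellipse p ∩ ball l₁).Nonempty) (h₂ : (ellipse p ∩ frontier (ball l₂)).Nonempty) :
    p ∈ crossingParams l₁ l₂ := by
  obtain ⟨y, hyp, hy⟩ := h₁
  obtain ⟨w, hwp, hw⟩ := h₂
  intro hR
  replace hy : ‖y‖ ≤ l₁ := by simpa [ball] using hy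
  replace hw : l₂ ≤ ‖w‖ := by
    have h2 := hw.2
    by_contra! hlt
    exact h2 (Metric.ball_subset_interior_closedBall (by simpa using hlt))
  have dy := norm_sub_le_of_mem_ellipse hR hyp
  have dw := norm_sub_le_of_mem_ellipse hR hwp
  have ty : ‖p.1‖ ≤ ‖y‖ + ‖y - p.1‖ := by
    simpa using norm_sub_le y (y - p.1)
  have tw : ‖w‖ ≤ ‖w - p.1‖ + ‖p.1‖ := by simpa using norm_add_le (w - p.1) p.1
  have h3 := abs_across_le_one_of_mem_ellipse hyp
  have h4 := (abs_across_le p.2.2 y)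
  rw [across_sub] at h3
  refine ⟨by linarith, (abs_along_le _ _).trans (by linarith), ?_, by linarith, by linarith⟩
  rw [abs_le] at *
  constructor <;> linarith

/-- For a long ellipse (`l₁ ≤ R`) the centre lies in a box of sides `O(R)` and `O(l₁)`; for a short
one it lies in an annulus of radius `O(l₁)` and width `O(R)`. -/
lemma volume_section_crossingParams_le {l₁ l₂ R : ℝ} (V : ℝ) (h₁ : 1 ≤ l₁) (h₂ : 2 ≤ l₂ - l₁)
    (hR : 1 ≤ R) :
    volume ((fun z => (z, R, V)) ⁻¹' crossingParams l₁ l₂) ≤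
      (Set.Ici ((l₂ - l₁) / 2)).indicator
        (fun R => ENNReal.ofReal (8 * Real.pi * l₁ * R)) R := by
  by_cases hd : (l₂ - l₁) / 2 ≤ R
  swap
  · have : (fun z : Plane => (z, R, V)) ⁻¹' crossingParams l₁ l₂ = ∅ := by
      ext z
      simp only [crossingParams, Set.mem_preimage, Set.mem_ofPred_eq, Set.mem_empty_iff_false,
        iff_false]
      intro h
      exact hd (by linarith [(h hR).1])
    rw [this, measure_empty]
    exact zero_le
  rw [Set.indicator_of_mem (by exact hd)]
  have hpi := Real.pi_gt_three
  rcases le_or_gt l₁ R with hlR | hlR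
  · calc _ ≤ volume {z : Plane | |along V z| ≤ l₁ + R ∧ |across V z| ≤ l₁ + 1} :=
          measure_mono fun z hz => ⟨(hz hR).2.1, (hz hR).2.2.1⟩
      _ = ENNReal.ofReal (4 * ((l₁ + R) * (l₁ + 1))) := volume_rotated_box V (by linarith)
      _ ≤ _ := ENNReal.ofReal_le_ofReal (by
          have : (l₁ + R) * (l₁ + 1) ≤ (2 * R) * (2 * l₁) := by gcongr <;> linarith
          nlinarith [mul_nonneg (by linarith : 0 ≤ l₁) (by linarith : 0 ≤ R)])
  · calc _ ≤ volume {z : Plane | l₂ - R ≤ ‖z‖ ∧ ‖z‖ ≤ l₁ + R} :=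
          measure_mono fun z hz => ⟨(hz hR).2.2.2.1, (hz hR).2.2.2.2⟩
      _ ≤ ENNReal.ofReal (Real.pi * ((l₁ + R) ^ 2 - (l₂ - R) ^ 2)) :=
          volume_annulus_le (by linarith) (by linarith)
      _ ≤ _ := ENNReal.ofReal_le_ofReal (by
          have : (l₁ + R) ^ 2 - (l₂ - R) ^ 2 ≤ 8 * (l₁ * R) := by
            have : (l₁ + l₂) * (2 * R - (l₂ - l₁)) ≤ (4 * l₁) * (2 * R) := by
              gcongr <;> linarith
            nlinarith
          nlinarith)

instance : IsProbabilityMeasure angleLaw := by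
  constructor
  have : Real.pi / 2 - -(Real.pi / 2) = Real.pi := by ring
  simp only [angleLaw, Measure.smul_apply, Measure.restrict_apply_univ, Real.volume_Ioc,
    smul_eq_mul, this]
  rw [← ENNReal.ofReal_mul (by positivity), one_div_mul_cancel Real.pi_ne_zero,
    ENNReal.ofReal_one]

instance (α : ℝ) : SFinite (axisLaw α) := by unfold axisLaw; infer_instance

/-- A tail integral of the law of the semi-major axes. -/
lemma lintegral_axisLaw_tail_le {α a K : ℝ} (hα : 1 < α) (ha : 1 ≤ a) (hK : 0 ≤ K)
    {F : ℝ → ℝ≥0∞} (hF : Measurable F)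
    (hFle : ∀ R, 1 ≤ R → F R ≤ (Set.Ici a).indicator (fun R => ENNReal.ofReal (K * R)) R) :
    ∫⁻ R, F R ∂axisLaw α ≤ ENNReal.ofReal (K * (α / (α - 1)) * a ^ (1 - α)) := by
  have hdens : Measurable fun R : ℝ => ENNReal.ofReal (α * R ^ (-(1 + α))) := by fun_prop
  rw [axisLaw, lintegral_withDensity_eq_lintegral_mul _ hdens hF]
  calc ∫⁻ R in Set.Ici 1, ((fun R => ENNReal.ofReal (α * R ^ (-(1 + α)))) * F) R
      ≤ ∫⁻ R in Set.Ici 1, (Set.Ici a).indicator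
          (fun R => ENNReal.ofReal (K * α * R ^ (-α))) R := by
        refine setLIntegral_mono' measurableSet_Ici fun R hR => ?_
        have hR0 : 0 < R := lt_of_lt_of_le one_pos hR
        simp only [Pi.mul_apply]
        refine (mul_le_mul_right (hFle R hR) _).trans ?_
        by_cases h : R ∈ Set.Ici a
        · rw [Set.indicator_of_mem h, Set.indicator_of_mem h,
            ← ENNReal.ofReal_mul (by positivity)]
          refine ENNReal.ofReal_le_ofReal (le_of_eq ?_)
          rw [show -α = -(1 + α) + 1 by ring, Real.rpow_add_one hR0.ne']
          ring
        · rw [Set.indicator_of_notMem h, Set.indicator_of_notMem h, mul_zero]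
    _ ≤ ∫⁻ R, (Set.Ici a).indicator (fun R => ENNReal.ofReal (K * α * R ^ (-α))) R :=
        setLIntegral_le_lintegral _ _
    _ = ∫⁻ R in Set.Ioi a, ENNReal.ofReal (K * α * R ^ (-α)) := by
        rw [lintegral_indicator measurableSet_Ici, setLIntegral_congr Ioi_ae_eq_Ici.symm]
    _ = ENNReal.ofReal (∫ R in Set.Ioi a, K * α * R ^ (-α)) := by
        refine (ofReal_integral_eq_lintegral_ofReal ?_ ?_).symm
        · exact (integrableOn_Ioi_rpow_of_lt (by linarith) (by linarith)).const_mul _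
        · refine (ae_restrict_iff' measurableSet_Ioi).2 (Filter.Eventually.of_forall fun R hR => ?_)
          have : 0 < R := by linarith [Set.mem_Ioi.1 hR]
          positivity
    _ = _ := by
        rw [integral_const_mul, integral_Ioi_rpow_of_lt (by linarith) (by linarith)]
        congr 1
        rw [show -α + 1 = 1 - α by ring, show 1 - α = -(α - 1) by ring, neg_div_neg_eq]
        ring

lemma intensity_crossingParams_le {u α l₁ l₂ : ℝ} (hα : 1 < α) (hu : 0 ≤ u) (h₁ : 1 ≤ l₁)
    (h₂ : 2 ≤ l₂ - l₁) :
    intensity u α (crossingParams l₁ l₂) ≤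
      ENNReal.ofReal (u * (8 * Real.pi * (α / (α - 1)) * 2 ^ (α - 1)) * l₁
        * (l₂ - l₁) ^ (1 - α)) := by
  -- the value `⊤` on `R < 1` costs nothing, since the law of the axes does not charge that range
  set F : ℝ → ℝ≥0∞ := fun R => if R < 1 then ⊤ else (Set.Ici ((l₂ - l₁) / 2)).indicator
    (fun R => ENNReal.ofReal (8 * Real.pi * l₁ * R)) R with hF
  have hFm : Measurable F := by
    refine Measurable.ite measurableSet_Iio measurable_const
      (Measurable.indicator ?_ measurableSet_Ici)
    fun_prop
  have hle : ∫⁻ R, F R ∂axisLaw α ≤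
      ENNReal.ofReal (8 * Real.pi * l₁ * (α / (α - 1)) * ((l₂ - l₁) / 2) ^ (1 - α)) := by
    refine lintegral_axisLaw_tail_le hα (by linarith) (by positivity) hFm fun R hR => ?_
    simp only [hF, if_neg (not_lt.2 hR), le_refl]
  rw [intensity, Measure.smul_apply, smul_eq_mul,
    Measure.prod_apply_symm (measurableSet_crossingParams l₁ l₂)]
  calc _ ≤ ENNReal.ofReal u * ∫⁻ q : ℝ × ℝ, F q.1 ∂(axisLaw α).prod angleLaw := by
        gcongr with q
        by_cases hq : q.1 < 1
        · simp only [hF, if_pos hq, le_top]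
        · simp only [hF, if_neg hq]
          exact volume_section_crossingParams_le q.2 h₁ h₂ (not_lt.1 hq)
    _ = ENNReal.ofReal u * ∫⁻ R, F R ∂axisLaw α := by
        rw [lintegral_prod (fun q : ℝ × ℝ => F q.1) (hFm.comp measurable_fst).aemeasurable]
        simp
    _ ≤ ENNReal.ofReal u * ENNReal.ofReal
          (8 * Real.pi * l₁ * (α / (α - 1)) * ((l₂ - l₁) / 2) ^ (1 - α)) := by gcongr
    _ = _ := by
        rw [← ENNReal.ofReal_mul hu]
        congr 1
        rw [Real.div_rpow (by linarith) zero_le_two, show (2 : ℝ) ^ (1 - α) = (2 ^ (α - 1))⁻¹ by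
          rw [← Real.rpow_neg zero_le_two, neg_sub]]
        field_simp

/-! ### Hitting probabilities and translations of Poisson point processes -/

/-- The void probability of a Poisson point process, as a bound on the probability of a hit. -/
lemma IsPoissonPointProcess.measure_inter_nonempty_le {E Ω : Type*} [MeasurableSpace E]
    [MeasurableSpace Ω] {P : Measure Ω} [IsProbabilityMeasure P] {ξ : Ω → Set E} {Λ : Measure E}
    (hξ : IsPoissonPointProcess P ξ Λ) {B : Set E} (hB : MeasurableSet B) {t : ℝ}
    (ht : 0 ≤ t) (hΛ : Λ B ≤ ENNReal.ofReal t) :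
    P {ω | (ξ ω ∩ B).Nonempty} ≤ ENNReal.ofReal (1 - Real.exp (-t)) := by
  have hfin : Λ B ≠ ∞ := ne_top_of_le_ne_top ENNReal.ofReal_ne_top hΛ
  have h0 : P {ω | (ξ ω ∩ B).encard = 0} = ENNReal.ofReal (Real.exp (-(Λ B).toReal)) := by
    have hpre : (Nat.cast : ℕ → ℕ∞) ⁻¹' {0} = {0} := by ext k; simp
    have h := Measure.map_apply (hξ.measurable_count B hB) (measurableSet_singleton 0) (μ := P)
    rw [(hξ.hasLaw_count B hB hfin).map_eq, Measure.map_apply measurable_from_nat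
      (measurableSet_singleton (0 : ℕ∞)), hpre, poissonMeasure_singleton] at h
    rw [← ENNReal.coe_toNNReal_eq_toReal]
    refine h.symm.trans ?_
    simp
  have hmeas : MeasurableSet {ω | (ξ ω ∩ B).encard = 0} :=
    hξ.measurable_count B hB (measurableSet_singleton 0)
  have hc : {ω | (ξ ω ∩ B).Nonempty} = {ω | (ξ ω ∩ B).encard = 0}ᶜ := by
    ext ω
    simp [Set.nonempty_iff_ne_empty]
  rw [hc, prob_compl_eq_one_sub hmeas, h0, ← ENNReal.ofReal_one,
    ← ENNReal.ofReal_sub _ (Real.exp_pos _).le]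
  gcongr
  exact ENNReal.toReal_le_of_le_ofReal ht hΛ

lemma IsPoissonPointProcess.image_measurableEquiv {E Ω : Type*} [MeasurableSpace E]
    [MeasurableSpace Ω] {P : Measure Ω} {ξ : Ω → Set E} {Λ : Measure E}
    (hξ : IsPoissonPointProcess P ξ Λ) (e : E ≃ᵐ E) (he : MeasurePreserving e Λ Λ) :
    IsPoissonPointProcess P (fun ω => e '' ξ ω) Λ := by
  have key : ∀ (ω : Ω) (B : Set E), (e '' ξ ω ∩ B).encard = (ξ ω ∩ e ⁻¹' B).encard := by
    intro ω B
    rw [← Set.image_inter_preimage, e.injective.encard_image]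
  refine ⟨fun B hB => ?_, fun B hB hfin => ?_, fun m B hB hd => ?_⟩
  · simp only [key]
    exact hξ.measurable_count _ (e.measurable hB)
  · simp only [key]
    rw [← he.measure_preimage hB.nullMeasurableSet] at hfin ⊢
    exact hξ.hasLaw_count _ (e.measurable hB) hfin
  · simp only [key]
    exact hξ.iIndepFun_count m (fun i => e ⁻¹' B i) (fun i => e.measurable (hB i))
      fun i j hij => (hd hij).preimage _

/-- The translation of the centres that takes `c` to the origin. -/
noncomputable def recenter (c : Plane) : Param ≃ᵐ Param :=
  (MeasurableEquiv.subRight c).prodCongr (MeasurableEquiv.refl _)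

@[simp]
lemma recenter_apply (c : Plane) (p : Param) : recenter c p = (p.1 - c, p.2) := rfl

lemma IsEllipsesModel.recenter {Ω : Type*} [MeasurableSpace Ω] {P : Measure Ω}
    {ξ : Ω → Set Param} {u α : ℝ} (hξ : IsEllipsesModel P ξ u α) (c : Plane) :
    IsEllipsesModel P (fun ω => recenter c '' ξ ω) u α := by
  refine IsPoissonPointProcess.image_measurableEquiv hξ _ ?_
  exact MeasurePreserving.smul_measure
    ((measurePreserving_sub_right volume c).prod (MeasurePreserving.id _)) _

lemma sub_mem_ellipse_recenter {c y : Plane} {p : Param} :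
    y - c ∈ ellipse (recenter c p) ↔ y ∈ ellipse p := by
  rw [mem_ellipse_iff, mem_ellipse_iff, recenter_apply, sub_sub_sub_cancel_right]

theorem exists_isAnnulusConstant {α : ℝ} (hα : 1 < α) :
    ∃ c₂ : ℝ, IsAnnulusConstant.{v} α c₂ := by
  have hα' : 0 < α - 1 := by linarith
  refine ⟨8 * Real.pi * (α / (α - 1)) * 2 ^ (α - 1), by positivity, ?_⟩
  intro u hu Ω _ P _ ξ hξ l₁ l₂ h₁ h₂
  refine (measure_mono fun ω hω => ?_).trans
    (IsPoissonPointProcess.measure_inter_nonempty_le hξ (measurableSet_crossingParams l₁ l₂) ?_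
      (intensity_crossingParams_le hα hu.le h₁ h₂))
  · obtain ⟨p, hp, hp₁, hp₂⟩ := hω
    exact ⟨p, hp, mem_crossingParams hp₁ hp₂⟩
  · have : 0 ≤ l₂ - l₁ := by linarith
    positivity

/-! ### Chains of ellipses -/

/-- `x` and `y` are linked by one ellipse of `η`, or are equal. -/
def Step (η : Set Param) (x y : Plane) : Prop :=
  x = y ∨ ∃ p ∈ η, x ∈ ellipse p ∧ y ∈ ellipse p

/-- `y` can be reached from `x` in `k` steps, each inside one ellipse of `η`. Steps may be idle, so
this means "in at most `k` ellipses". -/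
def Chain (η : Set Param) : ℕ → Plane → Plane → Prop
  | 0, x, y => x = y
  | k + 1, x, y => ∃ z, Step η x z ∧ Chain η k z y

variable {η : Set Param}

lemma Chain.refl (k : ℕ) (x : Plane) : Chain η k x x := by
  induction k with
  | zero => rfl
  | succ k ih => exact ⟨x, Or.inl rfl, ih⟩

lemma Chain.succ {k : ℕ} {x y : Plane} (h : Chain η k x y) : Chain η (k + 1) x y :=
  ⟨x, Or.inl rfl, h⟩

lemma Chain.mono {j k : ℕ} (hjk : j ≤ k) {x y : Plane} (h : Chain η j x y) : Chain η k x y := by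
  induction k, hjk using Nat.le_induction with
  | base => exact h
  | succ k _ ih => exact ih.succ

lemma Chain.split {j k : ℕ} {x y : Plane} (h : Chain η (j + k) x y) :
    ∃ z, Chain η j x z ∧ Chain η k z y := by
  induction j generalizing x with
  | zero => exact ⟨x, rfl, by simpa using h⟩
  | succ j ih =>
    rw [Nat.succ_add_eq_add_succ] at h
    obtain ⟨w, hw, hc⟩ := h
    obtain ⟨z, hz, hz'⟩ := ih hc
    exact ⟨z, ⟨w, hw, hz⟩, hz'⟩

/-- A path in a union of `k` ellipses gives a chain of length `k`: follow one ellipse from the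
starting point to the last visit of the path; afterwards the path stays in the other `k - 1`. -/
lemma Chain.of_continuousOn {F : Finset Param} (hF : (F : Set Param) ⊆ η) {f : ℝ → Plane}
    {a b : ℝ} (hab : a ≤ b) (hf : ContinuousOn f (Set.Icc a b))
    (hfF : ∀ t ∈ Set.Icc a b, f t ∈ ⋃ p ∈ F, ellipse p) : Chain η F.card (f a) (f b) := by
  classical
  induction hk : F.card generalizing F a with
  | zero =>
    rw [Finset.card_eq_zero] at hk
    simpa [hk] using hfF a ⟨le_rfl, hab⟩
  | succ k ih =>
    obtain ⟨p, hp, hap⟩ : ∃ p ∈ F, f a ∈ ellipse p := by simpa using hfF a ⟨le_rfl, hab⟩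
    have hK : IsCompact (Set.Icc a b ∩ f ⁻¹' ellipse p) :=
      isCompact_Icc.of_isClosed_subset
        (hf.preimage_isClosed_of_isClosed isClosed_Icc (isClosed_ellipse p)) Set.inter_subset_left
    obtain ⟨t, ⟨⟨hat, htb⟩, htp⟩, htmax⟩ := hK.exists_isGreatest ⟨a, ⟨le_rfl, hab⟩, hap⟩
    have hstep : Step η (f a) (f t) := Or.inr ⟨p, hF hp, hap, htp⟩
    rcases htb.eq_or_lt with rfl | htb
    · exact ⟨_, hstep, Chain.refl _ _⟩
    have hf' : ContinuousOn f (Set.Icc t b) := hf.mono (Set.Icc_subset_Icc_left hat)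
    have hlt : ∀ s ∈ Set.Ioc t b, f s ∈ ⋃ q ∈ F.erase p, ellipse q := by
      intro s hs
      have hs' : s ∈ Set.Icc a b := ⟨hat.trans hs.1.le, hs.2⟩
      obtain ⟨q, hq, hsq⟩ : ∃ q ∈ F, f s ∈ ellipse q := by simpa using hfF s hs'
      have hqp : q ≠ p := by
        rintro rfl
        exact absurd (htmax ⟨hs', hsq⟩) (not_le.2 hs.1)
      exact Set.mem_biUnion (Finset.mem_erase.2 ⟨hqp, hq⟩) hsq
    have hclosed : IsClosed (⋃ q ∈ F.erase p, ellipse q) :=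
      (F.erase p).finite_toSet.isClosed_biUnion fun q _ => isClosed_ellipse q
    -- the point of last visit lies in the other ellipses too, by closedness
    have hle : Set.Icc t b ⊆ Set.Icc t b ∩ f ⁻¹' ⋃ q ∈ F.erase p, ellipse q := by
      have hc := hf'.preimage_isClosed_of_isClosed isClosed_Icc hclosed
      conv_lhs => rw [← closure_Ioc htb.ne]
      exact closure_minimal (fun s hs => ⟨Set.Ioc_subset_Icc_self hs, hlt s hs⟩) hc
    refine ⟨_, hstep, ih (F := F.erase p) ?_ htb.le hf' (fun s hs => (hle hs).2) ?_⟩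
    · exact fun q hq => hF (Finset.mem_of_mem_erase hq)
    · rw [Finset.card_erase_of_mem hp, hk, Nat.add_sub_cancel]

lemma Chain.of_joinedIn {F : Finset Param} (hF : (F : Set Param) ⊆ η) {x y : Plane}
    (h : JoinedIn (⋃ p ∈ F, ellipse p) x y) : Chain η F.card x y := by
  obtain ⟨f, hf⟩ := h
  have := Chain.of_continuousOn hF (f := f.extend) zero_le_one
    f.continuous_extend.continuousOn fun t ht => by
      rw [Path.extend_apply _ ht]; exact hf _
  simpa using this

/-- A step across a circle may be interrupted at a point of that circle, by convexity of ellipses. -/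
lemma Step.exists_norm_sub_eq {c x y : Plane} {l : ℝ} (h : Step η x y) (hx : ‖x - c‖ ≤ l)
    (hy : l ≤ ‖y - c‖) : ∃ z, ‖z - c‖ = l ∧ Step η x z ∧ Step η z y := by
  rcases h with rfl | ⟨p, hp, hxp, hyp⟩
  · exact ⟨x, le_antisymm hx hy, Or.inl rfl, Or.inl rfl⟩
  · have hconn := (convex_ellipse p).isPreconnected
    obtain ⟨z, hz, hzl⟩ := hconn.intermediate_value hxp hyp
      (f := fun z => ‖z - c‖) (by fun_prop) ⟨hx, hy⟩
    exact ⟨z, hzl, Or.inr ⟨p, hp, hxp, hz⟩, Or.inr ⟨p, hp, hz, hyp⟩⟩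

lemma Chain.exists_norm_sub_eq {k : ℕ} {c x y : Plane} {l : ℝ} (h : Chain η k x y)
    (hx : ‖x - c‖ ≤ l) (hy : l ≤ ‖y - c‖) :
    ∃ z, ‖z - c‖ = l ∧ Chain η k x z ∧ Chain η k z y := by
  induction k generalizing x with
  | zero =>
    obtain rfl : x = y := h
    exact ⟨x, le_antisymm hx hy, rfl, rfl⟩
  | succ k ih =>
    obtain ⟨w, hs, hc⟩ := h
    rcases le_total l ‖w - c‖ with hw | hw
    · obtain ⟨z, hzl, hxz, hzw⟩ := hs.exists_norm_sub_eq hx hw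
      exact ⟨z, hzl, ⟨z, hxz, Chain.refl _ _⟩, ⟨w, hzw, hc⟩⟩
    · obtain ⟨z, hzl, hwz, hzy⟩ := ih hc hw
      exact ⟨z, hzl, ⟨w, hs, hwz⟩, hzy.succ⟩

/-- At most `k` ellipses of `η` link the unit ball about `c` to the circle of radius `r` about
`c`. -/
def Crosses (η : Set Param) (k : ℕ) (c : Plane) (r : ℝ) : Prop :=
  ∃ x y, ‖x - c‖ ≤ 1 ∧ ‖y - c‖ = r ∧ Chain η k x y

lemma crosses_of_annulusChemDist_le {k : ℕ} {r : ℝ} (h : annulusChemDist η 1 r ≤ k) :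
    Crosses η k 0 r := by
  rw [← ENat.lt_add_one_iff (ENat.natCast_ne_top k), annulusChemDist, chemDistSets] at h
  simp only [chemDist, iInf_lt_iff, exists_prop] at h
  obtain ⟨x, hx, y, hy, F, hF, hj, hk⟩ := h
  rw [ENat.lt_add_one_iff (ENat.natCast_ne_top k), Nat.cast_le] at hk
  refine ⟨x, y, by simpa [ball] using hx, ?_, (Chain.of_joinedIn hF hj).mono hk⟩
  have := Metric.frontier_closedBall_subset_sphere hy
  simpa using this

/-- The half-way split: the first half of a chain crosses out to the circle of radius `l`, or the
second half crosses from that circle to the outer one. In the latter case it is seen from any point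
`a` of the circle near its starting point. -/
lemma Crosses.split {m : ℕ} {c : Plane} {r l : ℝ} (h : Crosses η (m + m) c r) (h1 : 1 ≤ l)
    (hlr : l + 1 ≤ r) {s : Set Plane} (hs : ∀ a ∈ s, ‖a - c‖ = l)
    (hcov : ∀ w, ‖w - c‖ = l → ∃ a ∈ s, ‖w - a‖ ≤ 1) :
    Crosses η m c l ∨ ∃ a ∈ s, Crosses η m a (r - l) := by
  obtain ⟨x, y, hx, hy, hxy⟩ := h
  obtain ⟨q, hxq, hqy⟩ := hxy.split
  rcases le_total l ‖q - c‖ with hq | hq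
  · obtain ⟨z, hz, hxz, -⟩ := hxq.exists_norm_sub_eq (hx.trans h1) hq
    exact Or.inl ⟨x, z, hx, hz, hxz⟩
  · obtain ⟨w, hw, -, hwy⟩ := hqy.exists_norm_sub_eq hq (by rw [hy]; linarith)
    obtain ⟨a, ha, hwa⟩ := hcov w hw
    have hya : r - l ≤ ‖y - a‖ := by
      have : ‖y - c‖ ≤ ‖y - a‖ + ‖a - c‖ := norm_sub_le_norm_sub_add_norm_sub y a c
      rw [hy, hs a ha] at this
      linarith
    obtain ⟨z, hz, hwz, -⟩ := hwy.exists_norm_sub_eq (hwa.trans (by linarith)) hya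
    exact Or.inr ⟨a, ha, w, z, hwa, hz, hwz⟩

lemma Crosses.oneConnected_recenter {c : Plane} {r : ℝ} (hr : 1 < r) (h : Crosses η 1 c r) :
    OneConnected (recenter c '' η) (ball 1) (frontier (ball r)) := by
  obtain ⟨x, y, hx, hy, z, hs, rfl⟩ := h
  rcases hs with rfl | ⟨p, hp, hxp, hyp⟩
  · linarith
  · refine ⟨_, Set.mem_image_of_mem _ hp, ⟨x - c, sub_mem_ellipse_recenter.2 hxp, ?_⟩,
      ⟨z - c, sub_mem_ellipse_recenter.2 hyp, ?_⟩⟩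
    · simpa [ball] using hx
    · rw [ball, frontier_closedBall _ (by linarith)]
      simpa using hy

/-- A circle of radius `l` is covered by unit balls centred at points of it whose angles are spaced
by `1 / l`. -/
lemma exists_finset_circle_cover (c : Plane) {l : ℝ} (hl : 0 < l) :
    ∃ s : Finset Plane, (s.card : ℝ) ≤ 2 * Real.pi * l + 1 ∧ (∀ a ∈ s, ‖a - c‖ = l) ∧
      ∀ w, ‖w - c‖ = l → ∃ a ∈ s, ‖w - a‖ ≤ 1 := by
  classical
  set pt : ℝ → Plane := fun φ => c + !₂[l * Real.cos φ, l * Real.sin φ] with hpt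
  have hpi := Real.pi_pos
  refine ⟨(Finset.range (⌊2 * Real.pi * l⌋₊ + 1)).image fun j : ℕ => pt (j / l - Real.pi),
    ?_, ?_, ?_⟩
  · calc _ ≤ ((⌊2 * Real.pi * l⌋₊ + 1 : ℕ) : ℝ) := by
          exact_mod_cast Finset.card_image_le.trans_eq (Finset.card_range _)
      _ ≤ _ := by
          push_cast
          gcongr
          exact Nat.floor_le (by positivity)
  · intro a ha
    obtain ⟨j, -, rfl⟩ := Finset.mem_image.1 ha
    rw [hpt, add_sub_cancel_left, ← sq_eq_sq₀ (norm_nonneg _) hl.le, EuclideanSpace.norm_sq_eq]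
    simp only [Fin.sum_univ_two, Real.norm_eq_abs, sq_abs]
    simp only [Matrix.cons_val_zero, Matrix.cons_val_one]
    linear_combination l ^ 2 * Real.sin_sq_add_cos_sq (j / l - Real.pi)
  · intro w hw
    set ζ : ℂ := ⟨(w - c) 0, (w - c) 1⟩ with hζ
    have hζl : ‖ζ‖ = l := by
      rw [← sq_eq_sq₀ (norm_nonneg _) hl.le, ← hw, EuclideanSpace.norm_sq_eq, Complex.sq_norm,
        Complex.normSq_apply, Fin.sum_univ_two, Real.norm_eq_abs, Real.norm_eq_abs, sq_abs, sq_abs]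
      ring
    have hwpt : w = pt ζ.arg := by
      have h0 := Complex.norm_mul_cos_arg ζ
      have h1 := Complex.norm_mul_sin_arg ζ
      rw [hζl] at h0 h1
      ext i
      fin_cases i
      · change w 0 = c 0 + l * Real.cos ζ.arg
        rw [h0]; simp [hζ]
      · change w 1 = c 1 + l * Real.sin ζ.arg
        rw [h1]; simp [hζ]
    have hθ := Complex.neg_pi_lt_arg ζ
    have hθ' := Complex.arg_le_pi ζ
    set θ := ζ.arg
    have hnn : 0 ≤ (θ + Real.pi) * l := mul_nonneg (by linarith) hl.le
    set j := ⌊(θ + Real.pi) * l⌋₊ with hj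
    refine ⟨pt (j / l - Real.pi), Finset.mem_image.2 ⟨j, ?_, rfl⟩, ?_⟩
    · rw [Finset.mem_range, Nat.lt_succ_iff]
      exact Nat.floor_mono (mul_le_mul_of_nonneg_right (by linarith) hl.le)
    · have hj1 := Nat.floor_le hnn
      have hj2 := Nat.lt_floor_add_one ((θ + Real.pi) * l)
      rw [← hj] at hj1 hj2
      set ψ := (j : ℝ) / l - Real.pi with hψ
      have hψl : (j : ℝ) = (ψ + Real.pi) * l := by rw [hψ]; field_simp; ring
      have hd : (l * (θ - ψ)) ^ 2 ≤ 1 := by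
        rw [hψl] at hj1 hj2
        have h1 : 0 ≤ l * (θ - ψ) := by linarith
        have h2 : l * (θ - ψ) ≤ 1 := by linarith
        nlinarith
      have hcos := Real.one_sub_sq_div_two_le_cos (x := θ - ψ)
      rw [Real.cos_sub] at hcos
      rw [hwpt, hpt, add_sub_add_left_eq_sub, ← sq_le_one_iff₀ (norm_nonneg _),
        EuclideanSpace.norm_sq_eq]
      simp only [Fin.sum_univ_two, Real.norm_eq_abs, sq_abs, PiLp.sub_apply]
      simp only [Matrix.cons_val_zero, Matrix.cons_val_one]
      nlinarith [Real.sin_sq_add_cos_sq θ, Real.sin_sq_add_cos_sq ψ,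
        mul_le_mul_of_nonneg_left hcos (sq_nonneg l)]

/-! ### The recursion over scales -/

/-- With the intermediate radius `r ^ g`, the two terms of the union
bound in the recursion are both of order `r ^ (-2 g ^ 2)`. -/
lemma recursion_bound {C X g r : ℝ} (hC : 15 ≤ C) (hX : 0 ≤ X) (hg : 0 < g) (hg' : g ≤ 1 / 2)
    (hr : 1 ≤ r) (hl : 4 ≤ r ^ g) (hlr : 2 * r ^ g ≤ r) :
    X * (r ^ g) ^ (-(2 * g)) + (2 * Real.pi * r ^ g + 1) * (X * (r - r ^ g) ^ (-(2 * g))) ≤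
      C * X * r ^ (-(2 * g ^ 2)) := by
  have hr0 : 0 < r := by linarith
  have e1 : (r ^ g) ^ (-(2 * g)) = r ^ (-(2 * g ^ 2)) := by
    rw [← Real.rpow_mul hr0.le]; ring_nf
  have e2 : (r - r ^ g) ^ (-(2 * g)) ≤ 2 * r ^ (-(2 * g)) := by
    calc (r - r ^ g) ^ (-(2 * g)) ≤ (r / 2) ^ (-(2 * g)) :=
          Real.rpow_le_rpow_of_nonpos (by linarith) (by linarith) (by linarith)
      _ = 2 ^ (2 * g) * r ^ (-(2 * g)) := by
          rw [Real.div_rpow hr0.le zero_le_two, Real.rpow_neg zero_le_two, div_inv_eq_mul, mul_comm]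
      _ ≤ 2 ^ (1 : ℝ) * r ^ (-(2 * g)) := by
          gcongr
          · norm_num
          · linarith
      _ = _ := by rw [Real.rpow_one]
  have e3 : r ^ g * r ^ (-(2 * g)) ≤ r ^ (-(2 * g ^ 2)) := by
    rw [← Real.rpow_add hr0]
    exact Real.rpow_le_rpow_of_exponent_le hr (by nlinarith)
  have hpi := Real.pi_lt_d2
  have e4 : 2 * Real.pi * r ^ g + 1 ≤ 7 * r ^ g := by nlinarith
  set A := r ^ (-(2 * g ^ 2)) with hA
  have hA0 : 0 ≤ A := by positivity
  have hrl : 0 ≤ r - r ^ g := by linarith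
  rw [e1]
  calc X * A + (2 * Real.pi * r ^ g + 1) * (X * (r - r ^ g) ^ (-(2 * g)))
      ≤ X * A + 7 * r ^ g * (X * (2 * r ^ (-(2 * g)))) := by gcongr
    _ = X * A + 14 * X * (r ^ g * r ^ (-(2 * g))) := by ring
    _ ≤ X * A + 14 * X * A := by gcongr
    _ = 15 * X * A := by ring
    _ ≤ C * X * A := by gcongr

lemma measure_crosses_one_le {Ω : Type v} [MeasurableSpace Ω] {P : Measure Ω}
    [IsProbabilityMeasure P] {ξ : Ω → Set Param} {u α c₂ : ℝ} (hα₁ : 1 < α) (hα₂ : α < 2)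
    (hu : 0 < u) (hc₂ : IsAnnulusConstant.{v} α c₂) (hξ : IsEllipsesModel P ξ u α) (c : Plane)
    {r : ℝ} (hr : 2 < r) :
    P {ω | Crosses (ξ ω) 1 c r} ≤
      ENNReal.ofReal (max 15 (u * 2 ^ (α - 1) * c₂) * r ^ (-(α - 1))) := by
  obtain ⟨hc₂0, hc₂⟩ := hc₂
  rcases le_or_gt 3 r with h3 | h3
  · refine (measure_mono fun ω hω => Crosses.oneConnected_recenter (by linarith) hω).trans
      ((hc₂ u hu Ω P _ (hξ.recenter c) 1 r le_rfl (by linarith)).trans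
        (ENNReal.ofReal_le_ofReal ?_))
    calc 1 - Real.exp (-(u * c₂ * 1 * (r - 1) ^ (1 - α)))
        ≤ u * c₂ * 1 * (r - 1) ^ (1 - α) := by
          linarith [Real.add_one_le_exp (-(u * c₂ * 1 * (r - 1) ^ (1 - α)))]
      _ ≤ u * c₂ * 1 * (r / 2) ^ (1 - α) := by
          gcongr ?_ * ?_
          exact Real.rpow_le_rpow_of_nonpos (by linarith) (by linarith) (by linarith)
      _ = u * 2 ^ (α - 1) * c₂ * r ^ (-(α - 1)) := by
          rw [Real.div_rpow (by linarith) zero_le_two, show 1 - α = -(α - 1) by ring,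
            Real.rpow_neg zero_le_two, div_inv_eq_mul]
          ring
      _ ≤ _ := by
          gcongr
          exact le_max_right _ _
  · -- here the annulus is too thin for the one-ellipse bound, but the claimed bound exceeds `1`
    refine prob_le_one.trans ?_
    rw [← ENNReal.ofReal_one]
    refine ENNReal.ofReal_le_ofReal ?_
    have hlow : (1 / 3 : ℝ) ≤ r ^ (-(α - 1)) := by
      calc (1 / 3 : ℝ) ≤ r⁻¹ := by rw [one_div]; gcongr
        _ = r ^ (-1 : ℝ) := (Real.rpow_neg_one r).symm
        _ ≤ _ := Real.rpow_le_rpow_of_exponent_le (by linarith) (by linarith)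
    nlinarith [le_max_left (15 : ℝ) (u * 2 ^ (α - 1) * c₂)]

theorem measure_crosses_two_pow_le {Ω : Type v} [MeasurableSpace Ω] {P : Measure Ω}
    [IsProbabilityMeasure P] {ξ : Ω → Set Param} {u α c₂ γ C : ℝ} (hα₁ : 1 < α) (hα₂ : α < 2)
    (hu : 0 < u) (hc₂ : IsAnnulusConstant.{v} α c₂) (hξ : IsEllipsesModel P ξ u α)
    (hγ : γ = (α - 1) / 2) (hC : C = max 15 (u * 2 ^ (α - 1) * c₂)) (n : ℕ) (c : Plane) {r : ℝ}
    (hr : (2 : ℝ) ^ (γ ^ (1 - (n : ℤ) - 2 ^ n)) < r) :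
    P {ω | Crosses (ξ ω) (2 ^ n) c r} ≤
      ENNReal.ofReal (C ^ (n + 1) * r ^ (-(2 * γ ^ (2 ^ n)))) := by
  have hγ0 : 0 < γ := by rw [hγ]; linarith
  have hγ1 : γ < 1 / 2 := by rw [hγ]; linarith
  have hC15 : 15 ≤ C := hC ▸ le_max_left _ _
  induction n generalizing c r with
  | zero =>
    have hr2 : 2 < r := by simpa using hr
    have := measure_crosses_one_le hα₁ hα₂ hu hc₂ hξ c hr2
    rw [← hC] at this
    have he : 2 * γ ^ (2 ^ 0) = α - 1 := by rw [hγ]; ring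
    rw [he, zero_add, pow_one, pow_zero]
    exact this
  | succ n ih =>
    set g := γ ^ (2 ^ n) with hg
    have hg0 : 0 < g := by positivity
    have hgγ : g ≤ γ := pow_le_of_le_one hγ0.le (by linarith) (by positivity)
    have hg1 : g ≤ 1 / 2 := by linarith
    set a : ℤ := 1 - (n : ℤ) - 2 ^ n with ha
    -- taking the power `g` lowers the threshold exponent from scale `n + 1` to below scale `n`
    have hexp : γ ^ (1 - ((n + 1 : ℕ) : ℤ) - 2 ^ (n + 1)) * g = γ ^ (a - 1) := by
      rw [hg, ← zpow_natCast γ (2 ^ n), ← zpow_add₀ hγ0.ne']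
      congr 1
      push_cast
      rw [ha]; ring
    have hr1 : 1 < r := (Real.one_lt_rpow one_lt_two (by positivity)).trans hr
    have hl : (2 : ℝ) ^ (γ ^ (a - 1)) < r ^ g := by
      rw [← hexp, Real.rpow_mul zero_le_two]
      exact Real.rpow_lt_rpow (by positivity) hr hg0
    have hmono : γ ^ a ≤ γ ^ (a - 1) :=
      zpow_le_zpow_right_of_le_one₀ hγ0 (by linarith) (by linarith)
    have hla : (2 : ℝ) ^ (γ ^ a) < r ^ g :=
      (Real.rpow_le_rpow_of_exponent_le one_le_two hmono).trans_lt hl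
    have h4 : 4 ≤ r ^ g := by
      have ha0 : a ≤ 0 := by
        have : (1 : ℤ) ≤ 2 ^ n := one_le_pow₀ (by norm_num)
        rw [ha]; linarith [Int.natCast_nonneg n]
      have h2 : 2 ≤ γ ^ (a - 1) := by
        calc (2 : ℝ) ≤ γ⁻¹ := by rw [le_inv_comm₀ two_pos hγ0]; linarith
          _ = γ ^ (-1 : ℤ) := (zpow_neg_one γ).symm
          _ ≤ _ := zpow_le_zpow_right_of_le_one₀ hγ0 (by linarith) (by linarith)
      calc (4 : ℝ) = 2 ^ (2 : ℝ) := by norm_num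
        _ ≤ 2 ^ (γ ^ (a - 1)) := Real.rpow_le_rpow_of_exponent_le one_le_two h2
        _ ≤ _ := hl.le
    set l := r ^ g with hldef
    have hl2 : l * l ≤ r := by
      rw [hldef, ← Real.rpow_add (by linarith)]
      calc r ^ (g + g) ≤ r ^ (1 : ℝ) := Real.rpow_le_rpow_of_exponent_le hr1.le (by linarith)
        _ = r := Real.rpow_one r
    have h4l : 4 * l ≤ r := (mul_le_mul_of_nonneg_right h4 (by linarith)).trans hl2
    obtain ⟨s, hcard, hs, hcov⟩ := exists_finset_circle_cover c (show 0 < l by linarith)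
    set X := C ^ (n + 1) with hX
    have hX0 : 0 ≤ X := by positivity
    have hrl : 0 ≤ r - l := by linarith
    have hsub : {ω | Crosses (ξ ω) (2 ^ (n + 1)) c r} ⊆ {ω | Crosses (ξ ω) (2 ^ n) c l} ∪
        ⋃ a ∈ s, {ω | Crosses (ξ ω) (2 ^ n) a (r - l)} := by
      intro ω hω
      rw [Set.mem_ofPred_eq, pow_succ, mul_two] at hω
      rcases hω.split (by linarith) (by linarith) (s := s) hs hcov with h | ⟨a, ha, h⟩
      · exact Or.inl h
      · exact Or.inr (Set.mem_biUnion ha h)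
    calc P {ω | Crosses (ξ ω) (2 ^ (n + 1)) c r}
        ≤ P {ω | Crosses (ξ ω) (2 ^ n) c l} +
          ∑ a ∈ s, P {ω | Crosses (ξ ω) (2 ^ n) a (r - l)} :=
          (measure_mono hsub).trans ((measure_union_le _ _).trans
            (add_le_add_right (measure_biUnion_finset_le _ _) _))
      _ ≤ ENNReal.ofReal (X * l ^ (-(2 * g))) +
          ∑ _a ∈ s, ENNReal.ofReal (X * (r - l) ^ (-(2 * g))) := by
          gcongr
          · exact ih c hla
          · exact ih _ (by linarith)
      _ = ENNReal.ofReal (X * l ^ (-(2 * g)) + s.card * (X * (r - l) ^ (-(2 * g)))) := by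
          rw [Finset.sum_const, nsmul_eq_mul, ENNReal.ofReal_add (by positivity) (by positivity),
            ENNReal.ofReal_mul (p := (s.card : ℝ)) (by positivity), ENNReal.ofReal_natCast]
      _ ≤ ENNReal.ofReal (X * l ^ (-(2 * g)) +
            (2 * Real.pi * l + 1) * (X * (r - l) ^ (-(2 * g)))) := by gcongr
      _ ≤ ENNReal.ofReal (C * X * r ^ (-(2 * g ^ 2))) :=
          ENNReal.ofReal_le_ofReal
            (recursion_bound hC15 hX0 hg0 hg1 hr1.le h4 (by linarith))
      _ = _ := by
          congr 2
          · rw [hX]; ring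
          · rw [hg, ← pow_mul, ← pow_succ]

end EllipsesModel

theorem mainTheorem3 (α : ℝ) (hα₁ : 1 < α) (hα₂ : α < 2) :
    (∃ c₂ : ℝ, EllipsesModel.IsAnnulusConstant.{v} α c₂) ∧
    ∀ c₂ : ℝ, EllipsesModel.IsAnnulusConstant.{v} α c₂ →
      ∀ (u : ℝ), 0 < u → ∀ (γ C : ℝ), γ = (α - 1) / 2 → C = max 15 (u * 2 ^ (α - 1) * c₂) →
      ∀ (Ω : Type v) [MeasurableSpace Ω] (P : Measure Ω) [IsProbabilityMeasure P]
        (ξ : Ω → Set EllipsesModel.Param), EllipsesModel.IsEllipsesModel P ξ u α →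
      ∀ (n : ℕ) (x : EllipsesModel.Plane), (2 : ℝ) ^ (γ ^ (1 - (n : ℤ) - 2 ^ n)) < ‖x‖ →
        P {ω | EllipsesModel.annulusChemDist (ξ ω) 1 ‖x‖ ≤ 2 ^ n} ≤
          ENNReal.ofReal (C ^ (n + 1) * ‖x‖ ^ (-(2 * γ ^ (2 ^ n)))) := by
  refine ⟨EllipsesModel.exists_isAnnulusConstant hα₁, ?_⟩
  intro c₂ hc₂ u hu γ C hγ hC Ω _ P _ ξ hξ n x hx
  refine (measure_mono fun ω hω => ?_).trans
    (EllipsesModel.measure_crosses_two_pow_le hα₁ hα₂ hu hc₂ hξ hγ hC n 0 hx)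
  exact EllipsesModel.crosses_of_annulusChemDist_le (by exact_mod_cast hω)
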